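/- Consider $N$ files, where file $n$ consists of $F_n\in\mathbb N$ bits and is requested with probability $p_n\ge 0$ ($\sum_n p_n=1$), and $K$ users, each with a cache of $M\ge 0$ bits. User $k$ is active with probability $p_{\mathrm a,k}$, and $\mathcal A\subseteq\{1,\dots,K\}$, with $A=|\mathcal A|$, denotes the random set of active users (any joint law with these marginals is allowed). Given $\mathcal A$, the active users request files independently according to $p$; the demand vector is $d_{\mathcal A}\in\{1,\dots,N\}^{\mathcal A}$ and $\mathcal D_{\mathcal A}$ is the set of distinct files in it. *Decentralized placement.* Fix $q=(q_1,\dots,q_N)$ with $$0\le q_n\le 1\ (n=1,\dots,N),\qquad \sum_{n=1}^N q_nF_n\le M, \qquad (*)$$ and $q_nF_n\in\mathbb Z$. Each user, independently over users and files and without knowing $\mathcal A$, caches a uniformly random set of $q_nF_n$ bits of file $n$. *Delivery.* Given the realized placement, $\mathcal A$ and $d_{\mathcal A}$, the server broadcasts a message computed from the files, whose number of bits (the rate) depends only on the placement, $\mathcal A$ and $d_{\mathcal A}$. A scheme is valid if, for all placements, all $\mathcal A$, all $d_{\mathcal A}$ and all file contents, every active user recovers its requested file without error from the message and its own cached bits.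 The average rate is the expectation of the rate over placement, $\mathcal A$ and $d_{\mathcal A}$. For $\mathcal D\subseteq\{1,\dots,N\}$ with $|\mathcal D|\le A$ put $$R_{\mathrm{lb}}(\mathcal D;q)=\max_{\pi:\{1,\dots,|\mathcal D|\}\to\mathcal D\ \text{bijective}}\ \sum_{s=0}^{A-1}\sum_{i=1}^{|\mathcal D|}\binom{A-i}{s}q_{\pi(i)}^{s}(1-q_{\pi(i)})^{A-s}F_{\pi(i)},$$ $$\bar R_{\mathrm{lb}}(q)=E_{\mathcal A}\Big[\sum_{\mathcal D\subseteq\{1,\dots,N\}}\ \sum_{d_{\mathcal A}:\ \mathcal D_{\mathcal A}=\mathcal D}\Big(\prod_{k\in\mathcal A}p_{d_k}\Big)R_{\mathrm{lb}}(\mathcal D;q)\Big].$$ **Theorem.** (1) For every $q$ as above and every valid delivery scheme: (a) for every $\mathcal A$ and $d_{\mathcal A}$, the rate, averaged over the random placement, is at least $R_{\mathrm{lb}}(\mathcal D_{\mathcal A};q)$; (b) the average rate is at least $\bar R_{\mathrm{lb}}(q)$; (c) for every real $\varepsilon$ and every individual placement: if, for a given $\mathcal A$, for every file $n$ and every $\mathcal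 S\subseteq\mathcal A$ the number of bits of file $n$ cached by all users in $\mathcal S$ and by no user in $\mathcal A\setminus\mathcal S$ is at least $(1-\varepsilon)q_n^{|\mathcal S|}(1-q_n)^{A-|\mathcal S|}F_n$, then for this placement and every $d_{\mathcal A}$ the rate is at least $(1-\varepsilon)R_{\mathrm{lb}}(\mathcal D_{\mathcal A};q)$; and if this holds for all $\mathcal A$, then for this placement the rate averaged over $\mathcal A$ and $d_{\mathcal A}$ is at least $(1-\varepsilon)\bar R_{\mathrm{lb}}(q)$. (2) The problem P3: $\min_q \bar R_{\mathrm{lb}}(q)$ over all real $q$ satisfying $(*)$ has a minimizer, and its optimal value is a lower bound on the average rate of every decentralized placement as above combined with every valid delivery scheme. -/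

import Mathlib

open Finset

noncomputable section

namespace DecentralizedCaching

/-- The library: file `n` is an arbitrary string of `F n` bits. -/
abbrev Library {N : ℕ} (F : Fin N → ℕ) : Type :=
  (n : Fin N) → Fin (F n) → Bool

/-- A realization of the (uncoded) cache placement: user `k` caches a set of exactly `m n` bits of
file `n`, for each user and each file. -/
abbrev Placement (K : ℕ) {N : ℕ} (F m : Fin N → ℕ) : Type :=
  Fin K → (n : Fin N) → {T : Finset (Fin (F n)) // T.card = m n}

/-- Demand vectors of the active users in `A`. -/
abbrev Demand {K : ℕ} (N : ℕ) (A : Finset (Fin K)) : Type := A → Fin N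

/-- The bits stored by user `k` under the placement `C`. -/
abbrev CacheContent {K N : ℕ} {F m : Fin N → ℕ} (C : Placement K F m) (k : Fin K) : Type :=
  (n : Fin N) → (C k n).1 → Bool

/-- What user `k` stores when the library is `W`. -/
def cached {K N : ℕ} {F m : Fin N → ℕ} (C : Placement K F m) (k : Fin K) (W : Library F) :
    CacheContent C k :=
  fun n j => W n j.1

/-- A valid delivery scheme. Knowing the realized placement, the active users and their demands, the
server broadcasts a message of `rate C A d` bits computed from the files; every active user recovers
its requested file, without error and for every content of the files, from the message and its own
cached bits. -/
structure DeliveryScheme (K : ℕ) {N : ℕ} (F m : Fin N → ℕ) where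
  /-- number of bits broadcast -/
  rate : Placement K F m → (A : Finset (Fin K)) → Demand N A → ℕ
  /-- the server's encoder -/
  encode : (C : Placement K F m) → (A : Finset (Fin K)) → (d : Demand N A) →
    Library F → (Fin (rate C A d) → Bool)
  /-- the users' decoders -/
  decode : (C : Placement K F m) → (A : Finset (Fin K)) → (d : Demand N A) → (k : A) →
    (Fin (rate C A d) → Bool) → CacheContent C k.1 → (Fin (F (d k)) → Bool)
  correct : ∀ C A d W k, decode C A d k (encode C A d W) (cached C k.1 W) = W (d k)

/-- The expected value of `f` under decentralized random placement: for each user and each file,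
independently, the `m n` cached bits are drawn uniformly among all sets of `m n` bits of file `n`
(that is, the placement is uniform over the product of these choices). -/
def expectPlacement {K N : ℕ} {F m : Fin N → ℕ} (f : Placement K F m → ℝ) : ℝ :=
  (∑ C : Placement K F m, f C) / (Fintype.card (Placement K F m) : ℝ)

/-- The expected value over a random active set with law `α`, and over the demands of the active
users, which are independent with popularity `p`. -/
def expectDemand {K N : ℕ} (α : Finset (Fin K) → ℝ) (p : Fin N → ℝ)
    (f : (A : Finset (Fin K)) → Demand N A → ℝ) : ℝ :=
  ∑ A : Finset (Fin K), α A * ∑ d : Demand N A, (∏ k : A, p (d k)) * f A d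

/-- The average rate, over placement, active users and demands. -/
def averageRate {K N : ℕ} {F m : Fin N → ℕ} (α : Finset (Fin K) → ℝ) (p : Fin N → ℝ)
    (S : DeliveryScheme K F m) : ℝ :=
  expectPlacement fun C => expectDemand α p fun A d => (S.rate C A d : ℝ)

/-- The set of distinct files in a demand vector. -/
def distinctFiles {K N : ℕ} {A : Finset (Fin K)} (d : Demand N A) : Finset (Fin N) :=
  univ.image d

/-- `R_lb(D; q)` for `a` active users. A bijection `π : {1, …, |D|} → D` is indexed by `Fin |D|`, so
that the `i`-th file has index `i - 1`. -/
def rateLB {N : ℕ} (F : Fin N → ℕ) (a : ℕ) (D : Finset (Fin N)) (q : Fin N → ℝ) : ℝ :=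
  (univ : Finset (Fin D.card ≃ D)).sup' ⟨D.equivFin.symm, mem_univ _⟩ fun π =>
    ∑ s ∈ range a, ∑ i : Fin D.card,
      ((a - (i.1 + 1)).choose s : ℝ) * q (π i) ^ s * (1 - q (π i)) ^ (a - s) * (F (π i) : ℝ)

/-- The objective of the optimization problem: the average of `R_lb(D_A; q)`. -/
def averageRateLB {K N : ℕ} (F : Fin N → ℕ) (α : Finset (Fin K) → ℝ) (p : Fin N → ℝ)
    (q : Fin N → ℝ) : ℝ :=
  ∑ A : Finset (Fin K), α A *
    ∑ D : Finset (Fin N), ∑ d : Demand N A with distinctFiles d = D,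
      (∏ k : A, p (d k)) * rateLB F A.card D q

/-- The constraints: fractions in `[0, 1]` that respect the cache size `M`. -/
def feasible {N : ℕ} (F : Fin N → ℕ) (M : ℝ) : Set (Fin N → ℝ) :=
  {q | (∀ n, 0 ≤ q n ∧ q n ≤ 1) ∧ ∑ n, q n * (F n : ℝ) ≤ M}

/-- The bits of file `n` that, among the active users `A`, are cached by those in `T` only. -/
def subfile {K N : ℕ} {F m : Fin N → ℕ} (C : Placement K F m) (A : Finset (Fin K)) (n : Fin N)
    (T : Finset (Fin K)) : Finset (Fin (F n)) :=
  univ.filter fun j => ∀ k ∈ A, (j ∈ (C k n).1 ↔ k ∈ T)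

/-- Up to a relative error `ε`, the subfiles for the active set `A` have at least the nominal sizes
`q_n ^ |T| (1 - q_n) ^ (|A| - |T|) F_n`. -/
def NominalSubfiles {K N : ℕ} {F m : Fin N → ℕ} (q : Fin N → ℝ) (ε : ℝ) (C : Placement K F m)
    (A : Finset (Fin K)) : Prop :=
  ∀ n, ∀ T ⊆ A, (1 - ε) * (q n ^ T.card * (1 - q n) ^ (A.card - T.card) * (F n : ℝ)) ≤
    ((subfile C A n T).card : ℝ)

end DecentralizedCaching

end

open Finset

namespace DecentralizedCaching

/-! The lower bound is a successive-decoding argument. Order the distinct requested files by `π` and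
pick one user per file. The first user decodes its file from the message and its cache; the part of
the second user's cache in that file is then known, and so on. So the message determines every bit
of the `i`-th file cached by none of the first `i` users, and the rate is at least the number of
such bits (`sum_card_uncached_le_rate`).

For random placement this number has mean `(1 - q) ^ i * F` for the `i`-th file; expanding `(q + (1
- q)) ^ (a - i)` turns it into the sum over `s` in `rateLB`. For an individual placement, the same
bits are split by the set of active users caching them, and the sizes of these subfiles are bounded
below one by one. The minimum in P3 exists by compactness and continuity. -/

variable {K N : ℕ} {F m : Fin N → ℕ}

/-- The bits of file `n` that no user in `B` caches. -/
def uncached (C : Placement K F m) (B : Finset (Fin K)) (n : Fin N) : Finset (Fin (F n)) :=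
  univ.filter fun j => ∀ k ∈ B, j ∉ (C k n).1

/-- The library whose bits in `U` are given by `x` and whose other bits vanish. -/
def fill (U : (n : Fin N) → Finset (Fin (F n))) (x : (Σ n, U n) → Bool) : Library F :=
  fun n j => if h : j ∈ U n then x ⟨n, j, h⟩ else false

lemma fill_injective (U : (n : Fin N) → Finset (Fin (F n))) : Function.Injective (fill U) := by
  intro x y h
  funext ⟨n, j, hj⟩
  have := congrFun (congrFun h n) j
  simpa [fill, hj] using this

/-- Successive decoding: if the users `k 0, k 1, …` request distinct files, the message carries
all the bits of each of these files that neither its user nor an earlier one caches. -/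
theorem sum_card_uncached_le_rate (S : DeliveryScheme K F m) (C : Placement K F m)
    (A : Finset (Fin K)) (d : Demand N A) {L : ℕ} (k : Fin L → A)
    (hinj : Function.Injective fun i => d (k i)) :
    ∑ i, (uncached C ((Iic i).image fun l => (k l).1) (d (k i))).card ≤ S.rate C A d := by
  classical
  -- The free bits. All others are set to zero, so encoding must be injective on the fillings of
  -- `U`.
  set U : (n : Fin N) → Finset (Fin (F n)) := fun n =>
    univ.filter fun j => ∃ i, d (k i) = n ∧ ∀ l ≤ i, j ∉ (C (k l) n).1 with hU
  have hle : ∑ i, (uncached C ((Iic i).image fun l => (k l).1) (d (k i))).card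
      ≤ ∑ n, (U n).card := by
    calc _ ≤ ∑ i, (U (d (k i))).card := by
          refine sum_le_sum fun i _ => card_le_card fun j hj => ?_
          simp only [uncached, mem_filter, mem_univ, true_and, mem_image, mem_Iic,
            forall_exists_index, and_imp, hU] at hj ⊢
          exact ⟨i, rfl, fun l hl => hj _ l hl rfl⟩
      _ = ∑ n ∈ univ.image fun i => d (k i), (U n).card :=
          (sum_image (f := fun n => (U n).card) fun i _ j _ h => hinj h).symm
      _ ≤ _ := sum_le_sum_of_subset (subset_univ _)
  refine hle.trans ?_
  have henc : Function.Injective fun x => S.encode C A d (fill U x) := by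
    intro x y hxy
    have hfile : ∀ i : Fin L, fill U x (d (k i)) = fill U y (d (k i)) := by
      intro i
      induction i using WellFoundedLT.induction with
      | ind i ih =>
        have hcache : cached C (k i) (fill U x) = cached C (k i) (fill U y) := by
          funext n ⟨j, hj⟩
          -- A cached bit of user `i` lies in a file already decoded, or outside `U`, where both
          -- libraries vanish.
          by_cases hn : ∃ i' < i, d (k i') = n
          · obtain ⟨i', hi', rfl⟩ := hn
            exact congrFun (ih i' hi') j
          · have hjU : j ∉ U n := by
              simp only [hU, mem_filter, mem_univ, true_and, not_exists, not_and]
              intro i' hi' h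
              exact h i (not_lt.1 fun hlt => hn ⟨i', hlt, hi'⟩) hj
            simp [cached, fill, hjU]
        have hx := S.correct C A d (fill U x) (k i)
        have hy := S.correct C A d (fill U y) (k i)
        rw [← hx, ← hy, hcache]
        exact congrArg (fun X => S.decode C A d (k i) X _) hxy
    refine fill_injective U (funext fun n => ?_)
    by_cases hn : ∃ i, d (k i) = n
    · obtain ⟨i, rfl⟩ := hn
      exact hfile i
    · funext j
      have hjU : j ∉ U n := by
        simp only [hU, mem_filter, mem_univ, true_and, not_exists, not_and]
        exact fun i hi => absurd ⟨i, hi⟩ hn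
      simp [fill, hjU]
  have := Fintype.card_le_of_injective _ henc
  simpa using (Nat.pow_le_pow_iff_right (by norm_num : 1 < 2)).1 (by simpa using this)

/-- Each bit is classified by the exact set of users in `A` that cache it; for an uncached bit this
set avoids `B`. -/
lemma card_uncached_eq_sum_subfile (C : Placement K F m) {A B : Finset (Fin K)} (hB : B ⊆ A)
    (n : Fin N) :
    (uncached C B n).card = ∑ T ∈ (A \ B).powerset, (subfile C A n T).card := by
  classical
  have hmaps : ∀ j ∈ uncached C B n, (A.filter fun k => j ∈ (C k n).1) ∈ (A \ B).powerset := by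
    intro j hj
    simp only [uncached, mem_filter, mem_univ, true_and] at hj
    simp only [mem_powerset, subset_iff, mem_filter, mem_sdiff]
    exact fun k hk => ⟨hk.1, fun hkB => hj k hkB hk.2⟩
  rw [card_eq_sum_card_fiberwise hmaps]
  refine sum_congr rfl fun T hT => congrArg card ?_
  ext j
  simp only [uncached, subfile, mem_filter, mem_univ, true_and]
  have hT' := mem_powerset.1 hT
  constructor
  · rintro ⟨-, rfl⟩ k hk
    simp [hk]
  · intro h
    refine ⟨fun k hk hj => ?_, ?_⟩
    · exact (mem_sdiff.1 (hT' ((h k (hB hk)).1 hj))).2 hk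
    · ext k
      simp only [mem_filter]
      exact ⟨fun hk => (h k hk.1).1 hk.2, fun hk =>
        ⟨(mem_sdiff.1 (hT' hk)).1, (h k (mem_sdiff.1 (hT' hk)).1).2 hk⟩⟩

lemma sum_powerset_pow_mul_pow (x y : ℝ) {a i : ℕ} (hi : i < a) {B : Finset (Fin K)}
    (hB : B.card = a - (i + 1)) :
    ∑ T ∈ B.powerset, x ^ T.card * y ^ (a - T.card) =
      ∑ s ∈ range a, ((a - (i + 1)).choose s : ℝ) * x ^ s * y ^ (a - s) := by
  rw [sum_powerset_apply_card (fun s => x ^ s * y ^ (a - s)), hB]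
  simp only [nsmul_eq_mul, mul_assoc]
  refine sum_subset (fun s hs => ?_) fun s _ hs => ?_
  · simp only [mem_range] at hs ⊢
    omega
  · rw [mem_range, not_lt] at hs
    rw [Nat.choose_eq_zero_of_lt (by omega)]
    simp

/-- This is the binomial theorem multiplied by `(1 - x) ^ (i + 1)`; terms with `s > a - (i + 1)`
vanish. -/
lemma sum_choose_mul_pow_mul_pow (x : ℝ) {a i : ℕ} (hi : i < a) :
    ∑ s ∈ range a, ((a - (i + 1)).choose s : ℝ) * x ^ s * (1 - x) ^ (a - s) =
      (1 - x) ^ (i + 1) := by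
  have hsub : ∑ s ∈ range a, ((a - (i + 1)).choose s : ℝ) * x ^ s * (1 - x) ^ (a - s) =
      ∑ s ∈ range (a - (i + 1) + 1),
        ((a - (i + 1)).choose s : ℝ) * x ^ s * (1 - x) ^ (a - s) := by
    refine (sum_subset (fun s hs => ?_) fun s _ hs => ?_).symm
    · simp only [mem_range] at hs ⊢
      omega
    · rw [mem_range, not_lt] at hs
      rw [Nat.choose_eq_zero_of_lt (by omega)]
      simp
  have hbin := (by simp : (1 : ℝ) = (x + (1 - x)) ^ (a - (i + 1))).trans (add_pow _ _ _)
  have hmul := congrArg ((1 - x) ^ (i + 1) * ·) hbin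
  simp only [mul_one, mul_sum] at hmul
  rw [hsub, hmul]
  refine sum_congr rfl fun s hs => ?_
  rw [mem_range] at hs
  rw [show a - s = (i + 1) + (a - (i + 1) - s) by omega, pow_add]
  ring

/-- For each ordering of the requested files, users requesting them in that order. -/
lemma exists_users {A : Finset (Fin K)} (d : Demand N A)
    (π : Fin (distinctFiles d).card ≃ distinctFiles d) :
    ∃ k : Fin (distinctFiles d).card → A, (∀ i, d (k i) = π i) ∧
      (Function.Injective fun i => d (k i)) := by
  have h : ∀ i, ∃ k, d k = π i := fun i => by
    obtain ⟨k, -, hk⟩ := mem_image.1 (π i).2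
    exact ⟨k, hk⟩
  choose k hk using h
  refine ⟨k, hk, fun i j hij => π.injective (Subtype.ext ?_)⟩
  simpa [hk] using hij

lemma card_distinctFiles_le {A : Finset (Fin K)} (d : Demand N A) :
    (distinctFiles d).card ≤ A.card := by
  simpa [distinctFiles] using card_image_le (s := (univ : Finset A)) (f := d)

lemma card_image_Iic {A : Finset (Fin K)} {d : Demand N A} {L : ℕ} {k : Fin L → A}
    (hinj : Function.Injective fun i => d (k i)) (i : Fin L) :
    ((Iic i).image fun l => (k l).1).card = i.1 + 1 := by
  rw [card_image_of_injective _ fun a b h => hinj (congrArg d (Subtype.ext h)), Fin.card_Iic]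

theorem rateLB_le_rate_of_nominalSubfiles (S : DeliveryScheme K F m) (q : Fin N → ℝ) (ε : ℝ)
    (C : Placement K F m) (A : Finset (Fin K)) (hC : NominalSubfiles q ε C A) (d : Demand N A) :
    (1 - ε) * rateLB F A.card (distinctFiles d) q ≤ (S.rate C A d : ℝ) := by
  classical
  -- Since `1 - ε` may be negative, it is not moved inside the maximum; a maximizing ordering is
  -- fixed instead.
  obtain ⟨π, -, hπ⟩ := exists_mem_eq_sup' (s := (univ : Finset
    (Fin (distinctFiles d).card ≃ distinctFiles d))) ⟨(distinctFiles d).equivFin.symm, mem_univ _⟩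
    fun π => ∑ s ∈ range A.card, ∑ i : Fin (distinctFiles d).card,
      ((A.card - (i.1 + 1)).choose s : ℝ) * q (π i) ^ s * (1 - q (π i)) ^ (A.card - s) *
        (F (π i) : ℝ)
  rw [rateLB, hπ]
  obtain ⟨k, hk, hinj⟩ := exists_users d π
  refine le_trans ?_ (Nat.cast_le.2 (sum_card_uncached_le_rate S C A d k hinj))
  rw [sum_comm, mul_sum, Nat.cast_sum]
  refine sum_le_sum fun i _ => ?_
  have hsub : ((Iic i).image fun l => (k l).1) ⊆ A := by
    intro u hu
    obtain ⟨l, -, rfl⟩ := mem_image.1 hu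
    exact (k l).2
  have hi : i.1 < A.card := i.2.trans_le (card_distinctFiles_le d)
  rw [card_uncached_eq_sum_subfile C hsub, ← sum_mul,
    ← sum_powerset_pow_mul_pow _ _ hi
      (B := A \ (Iic i).image fun l => (k l).1)
      (by rw [card_sdiff_of_subset hsub, card_image_Iic hinj]),
    hk, sum_mul, mul_sum, Nat.cast_sum]
  exact sum_le_sum fun T hT => hC _ T ((mem_powerset.1 hT).trans sdiff_subset)

/-! ### Averages over the random placement -/

lemma card_filter_notMem {f c : ℕ} (j : Fin f) :
    (univ.filter fun T : {T : Finset (Fin f) // T.card = c} => j ∉ T.1).card =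
      (f - 1).choose c := by
  classical
  have : (univ.filter fun T : {T : Finset (Fin f) // T.card = c} => j ∉ T.1).map
      (Function.Embedding.subtype _) = powersetCard c (univ.erase j) := by
    ext T
    simp only [mem_map, mem_filter, mem_univ, true_and, Function.Embedding.subtype_apply,
      Subtype.exists, mem_powersetCard, subset_erase, subset_univ]
    constructor
    · rintro ⟨T, hT, hj, rfl⟩
      exact ⟨hj, hT⟩
    · rintro ⟨hj, hT⟩
      exact ⟨T, hT, hj, rfl⟩
  rw [← card_map, this, card_powersetCard, card_erase_of_mem (mem_univ _), card_univ,
    Fintype.card_fin]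

lemma choose_pred_div_choose {f c : ℕ} (hf : 0 < f) (hc : c ≤ f) {x : ℝ}
    (hx : (c : ℝ) = x * f) :
    ((f - 1).choose c : ℝ) / (f.choose c : ℝ) = 1 - x := by
  obtain ⟨g, rfl⟩ : ∃ g, f = g + 1 := ⟨f - 1, by omega⟩
  have hpos : (0 : ℝ) < ((g + 1).choose c : ℝ) := by exact_mod_cast Nat.choose_pos hc
  have h : ((g.choose c : ℝ)) * (g + 1) = (g + 1).choose c * (g + 1 - c) := by
    have h := Nat.choose_mul_succ_eq g c
    rw [← Nat.cast_inj (R := ℝ)] at h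
    push_cast [Nat.cast_sub hc] at h
    exact h
  have hg : (0 : ℝ) < g + 1 := by positivity
  rw [Nat.add_sub_cancel, div_eq_iff hpos.ne']
  push_cast at hx
  refine mul_right_cancel₀ hg.ne' (h.trans ?_)
  rw [hx]
  ring

/-- A bit of file `n` is uncached by every user in `B` with probability `(1 - q_n) ^ |B|`. -/
lemma card_filter_uncached_div (q : Fin N → ℝ) (hm : ∀ n, (m n : ℝ) = q n * (F n : ℝ))
    (hmF : ∀ n, m n ≤ F n) (B : Finset (Fin K)) (n : Fin N) (j : Fin (F n)) :
    ((univ.filter fun C : Placement K F m => j ∈ uncached C B n).card : ℝ) /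
      (Fintype.card (Placement K F m) : ℝ) = (1 - q n) ^ B.card := by
  classical
  -- The event is a product set, constrained only at users in `B` and file `n`; `h ▸ j` moves the
  -- bit to the type of file `n'`.
  have hset : (univ.filter fun C : Placement K F m => j ∈ uncached C B n) =
      Fintype.piFinset fun k => Fintype.piFinset fun n' =>
        univ.filter fun T : {T : Finset (Fin (F n')) // T.card = m n'} =>
          k ∈ B → ∀ h : n = n', h ▸ j ∉ T.1 := by
    ext C
    simp only [uncached, mem_filter, mem_univ, true_and, Fintype.mem_piFinset]
    constructor
    · rintro h k n' hk rfl
      exact h k hk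
    · exact fun h k hk => h k n hk rfl
  have htot : ∀ n', (0 : ℝ) < ((F n').choose (m n') : ℝ) := fun n' => by
    exact_mod_cast Nat.choose_pos (hmF n')
  rw [hset, Fintype.card_piFinset, Fintype.card_pi]
  simp only [Fintype.card_piFinset, Fintype.card_pi, Fintype.card_finset_len, Fintype.card_fin]
  push_cast
  simp only [← prod_div_distrib]
  have hk : ∀ k : Fin K, (∏ n', ((univ.filter fun T : {T : Finset (Fin (F n')) // T.card = m n'} =>
      k ∈ B → ∀ h : n = n', h ▸ j ∉ T.1).card : ℝ) / ((F n').choose (m n') : ℝ)) =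
      if k ∈ B then 1 - q n else 1 := by
    intro k
    rw [prod_eq_single n]
    · split_ifs with hkB
      · simp only [hkB, true_imp_iff]
        rw [← choose_pred_div_choose j.pos (hmF n) (hm n), ← card_filter_notMem (c := m n) j]
      · simp [hkB, Fintype.card_finset_len, (htot n).ne']
    · intro n' _ hn'
      simp [hn'.symm, Fintype.card_finset_len, (htot n').ne']
    · simp
  rw [prod_congr rfl fun k _ => hk k]
  simp

lemma expectPlacement_mono {f g : Placement K F m → ℝ} (h : ∀ C, f C ≤ g C) :
    expectPlacement f ≤ expectPlacement g :=
  div_le_div_of_nonneg_right (sum_le_sum fun C _ => h C) (Nat.cast_nonneg _)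

lemma expectPlacement_sum {ι : Type*} (s : Finset ι) (f : ι → Placement K F m → ℝ) :
    expectPlacement (fun C => ∑ i ∈ s, f i C) = ∑ i ∈ s, expectPlacement (f i) := by
  simp only [expectPlacement]
  rw [sum_comm, sum_div]

lemma expectPlacement_const_mul (c : ℝ) (f : Placement K F m → ℝ) :
    expectPlacement (fun C => c * f C) = c * expectPlacement f := by
  simp only [expectPlacement]
  rw [← mul_sum, mul_div_assoc]

lemma expectPlacement_card_uncached (q : Fin N → ℝ) (hm : ∀ n, (m n : ℝ) = q n * (F n : ℝ))
    (hmF : ∀ n, m n ≤ F n) (B : Finset (Fin K)) (n : Fin N) :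
    expectPlacement (fun C : Placement K F m => ((uncached C B n).card : ℝ)) =
      (1 - q n) ^ B.card * (F n : ℝ) := by
  classical
  have h : ∀ C : Placement K F m, ((uncached C B n).card : ℝ) =
      ∑ j, if j ∈ uncached C B n then (1 : ℝ) else 0 := fun C => by simp
  simp only [h]
  rw [expectPlacement_sum]
  have h' : ∀ j, expectPlacement (fun C : Placement K F m =>
      if j ∈ uncached C B n then (1 : ℝ) else 0) = (1 - q n) ^ B.card := fun j => by
    rw [← card_filter_uncached_div q hm hmF B n j, expectPlacement, sum_boole]
  simp only [h', sum_const, card_univ, Fintype.card_fin, nsmul_eq_mul]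
  ring

/-- The chosen users depend on `d` and `π` but not on `C`, so each ordering can be averaged
separately before taking the maximum. -/
theorem rateLB_le_expectPlacement_rate (S : DeliveryScheme K F m) (q : Fin N → ℝ)
    (hm : ∀ n, (m n : ℝ) = q n * (F n : ℝ)) (hmF : ∀ n, m n ≤ F n) (A : Finset (Fin K))
    (d : Demand N A) :
    rateLB F A.card (distinctFiles d) q ≤ expectPlacement fun C => (S.rate C A d : ℝ) := by
  refine sup'_le _ _ fun π _ => ?_
  obtain ⟨k, hk, hinj⟩ := exists_users d π
  refine le_trans (le_of_eq ?_) (expectPlacement_mono fun C =>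
    Nat.cast_le.2 (sum_card_uncached_le_rate S C A d k hinj))
  simp only [Nat.cast_sum]
  rw [sum_comm, expectPlacement_sum]
  refine sum_congr rfl fun i _ => ?_
  rw [expectPlacement_card_uncached q hm hmF, card_image_Iic hinj, ← sum_mul,
    sum_choose_mul_pow_mul_pow _ (i.2.trans_le (card_distinctFiles_le d)), hk]

/-! ### Averages over demands, and the optimization problem -/

lemma expectDemand_mono {α : Finset (Fin K) → ℝ} {p : Fin N → ℝ} (hα : ∀ A, 0 ≤ α A)
    (hp : ∀ n, 0 ≤ p n) {f g : (A : Finset (Fin K)) → Demand N A → ℝ}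
    (h : ∀ A d, f A d ≤ g A d) : expectDemand α p f ≤ expectDemand α p g :=
  sum_le_sum fun A _ => mul_le_mul_of_nonneg_left (sum_le_sum fun d _ =>
    mul_le_mul_of_nonneg_left (h A d) (prod_nonneg fun _ _ => hp _)) (hα A)

lemma expectDemand_const_mul (α : Finset (Fin K) → ℝ) (p : Fin N → ℝ) (c : ℝ)
    (f : (A : Finset (Fin K)) → Demand N A → ℝ) :
    expectDemand α p (fun A d => c * f A d) = c * expectDemand α p f := by
  simp only [expectDemand, mul_sum]
  exact sum_congr rfl fun A _ => sum_congr rfl fun d _ => by ring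

lemma averageRateLB_eq_expectDemand (F : Fin N → ℕ) (α : Finset (Fin K) → ℝ) (p q : Fin N → ℝ) :
    averageRateLB F α p q =
      expectDemand α p fun A d => rateLB F A.card (distinctFiles d) q := by
  refine sum_congr rfl fun A _ => congrArg _ ?_
  rw [← sum_fiberwise univ distinctFiles]
  refine sum_congr rfl fun D _ => sum_congr rfl fun d hd => ?_
  simp only [(mem_filter.1 hd).2]

lemma averageRate_eq_expectDemand (α : Finset (Fin K) → ℝ) (p : Fin N → ℝ)
    (S : DeliveryScheme K F m) :
    averageRate α p S =
      expectDemand α p fun A d => expectPlacement fun C => (S.rate C A d : ℝ) := by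
  simp only [averageRate, expectDemand]
  rw [expectPlacement_sum]
  refine sum_congr rfl fun A _ => ?_
  rw [expectPlacement_const_mul, expectPlacement_sum]
  simp only [expectPlacement_const_mul]

lemma continuous_rateLB (F : Fin N → ℕ) (a : ℕ) (D : Finset (Fin N)) :
    Continuous (rateLB F a D) := by
  unfold rateLB
  exact Continuous.finset_sup'_apply _ fun π _ => by fun_prop

lemma continuous_averageRateLB (F : Fin N → ℕ) (α : Finset (Fin K) → ℝ) (p : Fin N → ℝ) :
    Continuous (averageRateLB F α p) := by
  have := continuous_rateLB F
  unfold averageRateLB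
  fun_prop

lemma isCompact_feasible (F : Fin N → ℕ) (M : ℝ) : IsCompact (feasible F M) := by
  have h : feasible F M = Set.Icc 0 1 ∩ {q | ∑ n, q n * (F n : ℝ) ≤ M} := by
    ext q
    simp [feasible, Pi.le_def, forall_and]
  rw [h]
  exact isCompact_Icc.inter_right (isClosed_le (by fun_prop) continuous_const)

lemma averageRateLB_le_averageRate {α : Finset (Fin K) → ℝ} {p : Fin N → ℝ} (hα : ∀ A, 0 ≤ α A)
    (hp : ∀ n, 0 ≤ p n) (S : DeliveryScheme K F m) (q : Fin N → ℝ)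
    (hm : ∀ n, (m n : ℝ) = q n * (F n : ℝ)) (hmF : ∀ n, m n ≤ F n) :
    averageRateLB F α p q ≤ averageRate α p S := by
  rw [averageRateLB_eq_expectDemand, averageRate_eq_expectDemand]
  exact expectDemand_mono hα hp (rateLB_le_expectPlacement_rate S q hm hmF)

/-- This makes the placement space nonempty, so `expectPlacement` is a genuine average. -/
lemma le_size_of_mem_feasible {M : ℝ} {q : Fin N → ℝ} (hq : q ∈ feasible F M)
    (hm : ∀ n, (m n : ℝ) = q n * (F n : ℝ)) (n : Fin N) : m n ≤ F n := by
  have : (m n : ℝ) ≤ F n := (hm n).trans_le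
    (mul_le_of_le_one_left (Nat.cast_nonneg _) (hq.1 n).2)
  exact_mod_cast this

end DecentralizedCaching

open DecentralizedCaching in
theorem theorem1 (K N : ℕ) (F : Fin N → ℕ) (M : ℝ) (hM : 0 ≤ M)
    (p : Fin N → ℝ) (hp : ∀ n, 0 ≤ p n) (hp1 : ∑ n, p n = 1)
    (pa : Fin K → ℝ)
    (α : Finset (Fin K) → ℝ) (hα : ∀ A, 0 ≤ α A) (hα1 : ∑ A, α A = 1)
    (hpa : ∀ k, ∑ A : Finset (Fin K) with k ∈ A, α A = pa k) :
    (∀ q ∈ feasible F M, ∀ m : Fin N → ℕ, (∀ n, (m n : ℝ) = q n * (F n : ℝ)) →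
      ∀ S : DeliveryScheme K F m,
        (∀ (A : Finset (Fin K)) (d : Demand N A),
          rateLB F A.card (distinctFiles d) q ≤ expectPlacement fun C => (S.rate C A d : ℝ)) ∧
        averageRateLB F α p q ≤ averageRate α p S ∧
        (∀ (ε : ℝ) (C : Placement K F m),
          (∀ A, NominalSubfiles q ε C A →
            ∀ d : Demand N A,
              (1 - ε) * rateLB F A.card (distinctFiles d) q ≤ (S.rate C A d : ℝ)) ∧
          ((∀ A, NominalSubfiles q ε C A) →
            (1 - ε) * averageRateLB F α p q ≤
              expectDemand α p fun A d => (S.rate C A d : ℝ)))) ∧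
    (∃ q₀ ∈ feasible F M, IsMinOn (averageRateLB F α p) (feasible F M) q₀ ∧
      ∀ q ∈ feasible F M, ∀ m : Fin N → ℕ, (∀ n, (m n : ℝ) = q n * (F n : ℝ)) →
        ∀ S : DeliveryScheme K F m, averageRateLB F α p q₀ ≤ averageRate α p S) := by
  refine ⟨fun q hq m hm S => ?_, ?_⟩
  · have hmF := le_size_of_mem_feasible hq hm
    refine ⟨rateLB_le_expectPlacement_rate S q hm hmF,
      averageRateLB_le_averageRate hα hp S q hm hmF, fun ε C =>
        ⟨rateLB_le_rate_of_nominalSubfiles S q ε C, fun hC => ?_⟩⟩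
    rw [averageRateLB_eq_expectDemand, ← expectDemand_const_mul]
    exact expectDemand_mono hα hp fun A d =>
      rateLB_le_rate_of_nominalSubfiles S q ε C A (hC A) d
  · obtain ⟨q₀, hq₀, hmin⟩ := (isCompact_feasible F M).exists_isMinOn
      ⟨0, by simp [feasible, hM]⟩ (continuous_averageRateLB F α p).continuousOn
    exact ⟨q₀, hq₀, hmin, fun q hq m hm S => (hmin hq).trans
      (averageRateLB_le_averageRate hα hp S q hm (le_size_of_mem_feasible hq hm))⟩
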